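/- Let $\Gamma$ be a countably infinite discrete group acting continuously on a compact metrizable space $X$. Let $\mathcal{M}(X)$ be the space of Borel probability measures on $X$ with the weak$^*$-topology and the induced action of $\Gamma$ by push-forward, and for a positive integer $N$ let $\mathcal{M}_N(X)\subseteq\mathcal{M}(X)$ be the $\Gamma$-invariant subspace of measures whose support has at most $N$ points. For an action of $\Gamma$ on a topological space $Y$, a positive integer $k$ and subsets $A_1,\dots,A_k\subseteq Y$, a set $F\subseteq\Gamma$ is called an independence set for $(A_1,\dots,A_k)$ if $\bigcap_{s\in J}s^{-1}A_{\sigma(s)}\neq\emptyset$ for every nonempty finite set $J\subseteq F$ and every map $\sigma:J\to\{1,\dots,k\}$. Let $\mathrm{IN}_k(Y)\subseteq Y^k$ be the set of all $(y_1,\dots,y_k)$ such that for every choice of neighborhoods $U_j$ of $y_j$ in $Y$ $(1\le j\le k)$, the tuple $(U_1,\dots,U_k)$ has independence sets of arbitrarily large finite cardinality. Then for all positive integers $k$ and $N_1,\dots,N_k$, setting $N=\prod_{j=1}^k N_j$, one has $$\bigl(\mathcal{M}_{N_1}(X)\times\cdots\times\mathcal{M}_{N_k}(X)\bigr)\cap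 \mathrm{IN}_k(\mathcal{M}(X))\subseteq \mathrm{IN}_k(\mathcal{M}_N(X)),$$ where $\mathrm{IN}_k(\mathcal{M}_N(X))\subseteq\mathcal{M}_N(X)^k$ is computed for the action of $\Gamma$ on $\mathcal{M}_N(X)$ with the subspace topology and is regarded as a subset of $\mathcal{M}(X)^k$. -/

import Mathlib

open MeasureTheory Topology Filter

/-- The induced action of `Γ` on the Borel probability measures on `X`, by push-forward:
`(g • μ)(A) = μ(g⁻¹ A)`.  The space `ProbabilityMeasure X` carries Mathlib's topology of weak
convergence, i.e. the weak-* topology coming from continuous functions on `X`. -/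
noncomputable instance probabilityMeasureMulAction {Γ X : Type*} [Group Γ] [MulAction Γ X]
    [TopologicalSpace X] [ContinuousConstSMul Γ X] [MeasurableSpace X] [BorelSpace X] :
    MulAction Γ (ProbabilityMeasure X) where
  smul g μ := μ.map (f := fun x : X => g • x) (measurable_const_smul g).aemeasurable
  one_smul μ := by
    apply Subtype.ext
    change Measure.map (fun x : X => (1 : Γ) • x) (μ : Measure X) = (μ : Measure X)
    simp
  mul_smul g h μ := by
    apply Subtype.ext
    change Measure.map (fun x : X => (g * h) • x) (μ : Measure X) =
      Measure.map (fun x : X => g • x) (Measure.map (fun x : X => h • x) (μ : Measure X))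
    rw [Measure.map_map (measurable_const_smul g) (measurable_const_smul h)]
    congr 1
    funext x
    exact mul_smul g h x

theorem probabilityMeasure_toMeasure_smul {Γ X : Type*} [Group Γ] [MulAction Γ X]
    [TopologicalSpace X] [ContinuousConstSMul Γ X] [MeasurableSpace X] [BorelSpace X]
    (g : Γ) (μ : ProbabilityMeasure X) :
    ((g • μ : ProbabilityMeasure X) : Measure X) =
      (μ : Measure X).map (fun x : X => g • x) := rfl

/-- The support of `g • μ` is contained in the translate by `g` of the support of `μ`. -/
theorem support_smul_subset {Γ X : Type*} [Group Γ] [MulAction Γ X]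
    [TopologicalSpace X] [ContinuousConstSMul Γ X] [MeasurableSpace X] [BorelSpace X]
    (g : Γ) (μ : ProbabilityMeasure X) :
    ((g • μ : ProbabilityMeasure X) : Measure X).support ⊆
      (fun x : X => g • x) '' (μ : Measure X).support := by
  intro y hy
  refine ⟨g⁻¹ • y, ?_, smul_inv_smul g y⟩
  rw [Measure.mem_support_iff_forall] at hy ⊢
  intro U hU
  have hV : (fun x : X => g⁻¹ • x) ⁻¹' U ∈ 𝓝 y :=
    (continuous_const_smul g⁻¹).continuousAt.preimage_mem_nhds hU
  have h := hy _ hV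
  rw [probabilityMeasure_toMeasure_smul,
    show (fun x : X => g • x) = (Homeomorph.smul g).toMeasurableEquiv from rfl,
    MeasurableEquiv.map_apply] at h
  convert h using 2
  ext x
  simp

/-- `F ⊆ Γ` is an independence set for the tuple `A = (A₁, …, A_k)` of subsets of `Y`:
`⋂_{s ∈ J} s⁻¹ A_{σ(s)} ≠ ∅` for every nonempty finite `J ⊆ F` and every `σ : J → {1, …, k}`.
Here `s⁻¹ A = {y | s y ∈ A}`. -/
def IsIndependenceSet {Γ Y : Type*} [SMul Γ Y] {k : ℕ} (A : Fin k → Set Y) (F : Set Γ) : Prop :=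
  ∀ J : Finset Γ, J.Nonempty → (J : Set Γ) ⊆ F → ∀ σ : J → Fin k,
    (⋂ s : J, (fun y : Y => (s : Γ) • y) ⁻¹' A (σ s)).Nonempty

/-- The set of IN-tuples of length `k` of the action of `Γ` on `Y`: those `y ∈ Y^k` such that for
every product neighbourhood `U₁ × ⋯ × U_k` of `y`, the tuple `(U₁, …, U_k)` has arbitrarily large
finite independence sets. -/
def INTuples (Γ Y : Type*) [SMul Γ Y] [TopologicalSpace Y] (k : ℕ) : Set (Fin k → Y) :=
  {y | ∀ U : Fin k → Set Y, (∀ j, U j ∈ 𝓝 (y j)) →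
    ∀ n : ℕ, ∃ F : Finset Γ, n ≤ F.card ∧ IsIndependenceSet U (F : Set Γ)}

/-- The `Γ`-invariant set of Borel probability measures on `X` whose support has at most `N`
points.  As a type it carries the subspace topology and the restricted action of `Γ`. -/
def finSuppMeasures (Γ X : Type*) [Group Γ] [MulAction Γ X]
    [TopologicalSpace X] [ContinuousConstSMul Γ X] [MeasurableSpace X] [BorelSpace X] (N : ℕ) :
    SubMulAction Γ (ProbabilityMeasure X) where
  carrier := {μ | (μ : Measure X).support.encard ≤ N}
  smul_mem' g μ hμ :=
    (Set.encard_le_encard (support_smul_subset g μ)).trans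
      ((Set.encard_image_le _ _).trans hμ)

/-!
Let `μ j` be carried by the finite set `S j`, and let `V j x`, `x ∈ S j`, be small disjoint
neighborhoods of its points.  Take a large independence set `F ⊆ Γ` for small neighborhoods of the
measures `μ j`.  Ramsey's theorem yields a homogeneous sequence in `F`, cut into many blocks of
length `k`: which patterns of visits to the sets `V j x` are realized by points of `X` does not
depend on the `m`-tuple from the sequence along which one moves.  Choose a measure `ν` which the
`j`-th element of every block moves close to `μ j`.

Under a block, almost every point for `ν` follows an itinerary `φ ∈ ∏ j, S j`.  If the initial
elements of the first `m` blocks do not form an independence set for the tuple `(V j (φ j))_j`, then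
by homogeneity no point follows `φ` in more than `m` blocks, so on average over the blocks such
itineraries carry little mass.  In a block where they do, fix an assignment `τ` of indices to those
`m` initial elements and collapse the points with itinerary `φ` to one point realizing `τ` for `φ`.
The image of `ν` has at most `∏ j, #(S j)` atoms, and every `s` among the `m` elements moves it
close to `μ (τ s)`.
-/

open scoped ENNReal

section Ramsey

theorem exists_endHomogeneous {α κ : Type*} [LinearOrder α] {m : ℕ}
    (ramsey : ∀ L : ℕ, ∃ M : ℕ, ∀ (c : (Fin m → α) → κ) (s : Finset α), M ≤ s.card →
      ∃ t ⊆ s, L ≤ t.card ∧ ∃ d, ∀ a : Fin m → α, StrictMono a → (∀ i, a i ∈ t) → c a = d)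
    (L : ℕ) :
    ∃ M : ℕ, ∀ (c : (Fin (m + 1) → α) → κ) (s : Finset α), M ≤ s.card →
      ∃ t ⊆ s, L ≤ t.card ∧ ∃ d : α → κ, ∀ a : Fin (m + 1) → α, StrictMono a →
        (∀ i, a i ∈ t) → c a = d (a 0) := by
  induction L with
  | zero =>
    exact ⟨0, fun c s _ => ⟨∅, by simp, by simp, fun x => c fun _ => x,
      fun a _ ha => absurd (ha 0) (by simp)⟩⟩
  | succ L ih =>
    obtain ⟨M, hM⟩ := ih
    obtain ⟨M', hM'⟩ := ramsey M
    refine ⟨M' + 1, fun c s hs => ?_⟩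
    have hne : s.Nonempty := Finset.card_pos.mp (by omega)
    set x := s.min' hne
    have hxs : x ∈ s := s.min'_mem hne
    obtain ⟨t', ht's, ht'M, dx, hdx⟩ := hM' (fun a => c (Fin.cons x a)) (s.erase x)
      (by rw [Finset.card_erase_of_mem hxs]; omega)
    obtain ⟨t, htt', htL, d, hd⟩ := hM c t' ht'M
    have hxt : ∀ y ∈ t, x < y := fun y hy => s.min'_lt_of_mem_erase_min' hne (ht's (htt' hy))
    have hts : t ⊆ s := htt'.trans (ht's.trans (Finset.erase_subset _ _))
    refine ⟨insert x t, Finset.insert_subset hxs hts, ?_, Function.update d x dx,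
      fun a ha hat => ?_⟩
    · rw [Finset.card_insert_of_notMem fun h => (hxt x h).false]
      omega
    have hmem : ∀ i, x < a i → a i ∈ t := fun i hi => Finset.mem_of_mem_insert_of_ne (hat i) hi.ne'
    rcases Finset.mem_insert.mp (hat 0) with h0 | h0
    · have htail : c (Fin.cons x (Fin.tail a)) = dx :=
        hdx _ (ha.comp Fin.strictMono_succ) fun i => htt' (hmem _ (h0 ▸ ha i.succ_pos))
      rw [h0, Function.update_self, ← htail, ← h0, Fin.cons_self_tail]
    · rw [Function.update_of_ne (hxt _ h0).ne']
      exact hd a ha fun i => hmem i ((hxt _ h0).trans_le (ha.monotone i.zero_le))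

theorem exists_homogeneous (α κ : Type*) [LinearOrder α] [Finite κ] [Nonempty κ] (m L : ℕ) :
    ∃ M : ℕ, ∀ (c : (Fin m → α) → κ) (s : Finset α), M ≤ s.card →
      ∃ t ⊆ s, L ≤ t.card ∧ ∃ d, ∀ a : Fin m → α, StrictMono a → (∀ i, a i ∈ t) → c a = d := by
  classical
  have := Fintype.ofFinite κ
  induction m generalizing L with
  | zero =>
    exact ⟨L, fun c s hs => ⟨s, subset_rfl, hs, c default, fun a _ _ =>
      congrArg c (Subsingleton.elim _ _)⟩⟩
  | succ m ih =>
    obtain ⟨M, hM⟩ := exists_endHomogeneous ih (Fintype.card κ * L)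
    refine ⟨M, fun c s hs => ?_⟩
    obtain ⟨t, hts, ht, d, hd⟩ := hM c s hs
    obtain ⟨y, -, hy⟩ := Finset.exists_le_card_fiber_of_mul_le_card_of_maps_to (f := d)
      (fun _ _ => Finset.mem_univ _) Finset.univ_nonempty ht
    refine ⟨{x ∈ t | d x = y}, (Finset.filter_subset _ _).trans hts, hy, y, fun a ha hat => ?_⟩
    simp only [Finset.mem_filter] at hat
    exact (hd a ha fun i => (hat i).1).trans (hat 0).2

theorem exists_homogeneous_embedding (α κ Λ : Type*) [Finite κ] [Nonempty κ] [LinearOrder Λ]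
    [Finite Λ] (m : ℕ) :
    ∃ M : ℕ, ∀ (c : (Fin m → α) → κ) (s : Finset α), M ≤ s.card →
      ∃ u : Λ ↪ α, (∀ l, u l ∈ s) ∧ ∃ d, ∀ a : Fin m → Λ, StrictMono a → c (u ∘ a) = d := by
  obtain ⟨_, -⟩ := exists_wellFoundedLT α
  have := Fintype.ofFinite Λ
  obtain ⟨M, hM⟩ := exists_homogeneous α κ m (Fintype.card Λ)
  refine ⟨M, fun c s hs => ?_⟩
  obtain ⟨t, hts, ht, d, hd⟩ := hM c s hs
  let u : Λ ↪o α :=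
    (Fintype.orderIsoFinOfCardEq Λ rfl).symm.toOrderEmbedding.trans (t.orderEmbOfCardLe ht)
  have hut : ∀ l, u l ∈ t := fun l => t.orderEmbOfCardLe_mem ht _
  exact ⟨u.toEmbedding, fun l => hts (hut l), d,
    fun a ha => hd _ (u.strictMono.comp ha) fun i => hut (a i)⟩

end Ramsey

section Measure

theorem sum_measure_le_of_ncard_le {X β : Type*} [MeasurableSpace X] [Fintype β] (ν : Measure X)
    {E : β → Set X} (hE : ∀ b, MeasurableSet (E b)) {m : ℕ} (hm : ∀ y, {b | y ∈ E b}.ncard ≤ m) :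
    ∑ b, ν (E b) ≤ m * ν Set.univ := by
  classical
  calc ∑ b, ν (E b) = ∫⁻ y, ∑ b, (E b).indicator 1 y ∂ν := by
        rw [lintegral_finsetSum _ fun b _ => measurable_one.indicator (hE b)]
        simp_rw [lintegral_indicator_one (hE _)]
    _ ≤ ∫⁻ _, m ∂ν := by
        refine lintegral_mono fun y => ?_
        simpa only [Set.indicator_apply, Pi.one_apply, Finset.sum_boole, Nat.cast_le,
          Set.ncard_eq_toFinset_card', Set.toFinset_ofPred] using hm y
    _ = m * ν Set.univ := lintegral_const _

theorem exists_measure_iUnion_le {X β Φ : Type*} [MeasurableSpace X] [Finite β] [Nonempty β]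
    [Finite Φ] (ν : Measure X) [IsProbabilityMeasure ν] {C : β → Φ → Set X}
    (hC : ∀ b φ, MeasurableSet (C b φ)) {m : ℕ} (hm : ∀ φ y, {b | y ∈ C b φ}.ncard ≤ m)
    {δ : ℝ≥0∞} (hδ : Nat.card Φ * (m : ℝ≥0∞) ≤ Nat.card β * δ) : ∃ b, ν (⋃ φ, C b φ) ≤ δ := by
  have := Fintype.ofFinite β
  have := Fintype.ofFinite Φ
  suffices h : ∑ b, ν (⋃ φ, C b φ) ≤ ∑ _b : β, δ by
    simpa using ENNReal.exists_le_of_sum_le Finset.univ_nonempty h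
  calc ∑ b, ν (⋃ φ, C b φ) ≤ ∑ b, ∑ φ, ν (C b φ) :=
        Finset.sum_le_sum fun b _ => measure_iUnion_fintype_le _ _
    _ = ∑ φ, ∑ b, ν (C b φ) := Finset.sum_comm
    _ ≤ ∑ _φ : Φ, (m : ℝ≥0∞) := Finset.sum_le_sum fun φ _ => by
        simpa using sum_measure_le_of_ncard_le ν (hC · φ) (hm φ)
    _ ≤ ∑ _b : β, δ := by simpa using hδ

theorem exists_measurable_eq_on_cells {X Y ι : Type*} [MeasurableSpace X] [MeasurableSpace Y]
    [Countable ι] [Nonempty ι] {C : ι → Set X} (hC : ∀ i, MeasurableSet (C i))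
    (hdisj : Pairwise (Function.onFun Disjoint C)) (z : ι → Y) :
    ∃ f : X → Y, Measurable f ∧ Set.range f ⊆ Set.range z ∧ ∀ i, ∀ y ∈ C i, f y = z i := by
  let _ : MeasurableSpace ι := ⊤
  obtain ⟨π, hπ, hπC⟩ := exists_measurable_piecewise C hC (fun i _ => i)
    (fun _ => measurable_const)
    fun i j hij y hy => (Set.disjoint_left.mp (hdisj hij) hy.1 hy.2).elim
  exact ⟨z ∘ π, measurable_from_top.comp hπ, Set.range_comp_subset_range π z,
    fun i y hy => congrArg z (hπC i hy)⟩

theorem support_map_subset_of_range_subset {X Y : Type*} [MeasurableSpace X] [TopologicalSpace Y]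
    [MeasurableSpace Y] [OpensMeasurableSpace Y] (ν : Measure X) {f : X → Y} (hf : Measurable f)
    {T : Set Y} (hT : IsClosed T) (hfT : Set.range f ⊆ T) : (ν.map f).support ⊆ T := by
  refine Measure.support_subset_of_isClosed hT
    ((mem_ae_map_iff hf.aemeasurable hT.measurableSet).mpr ?_)
  rw [Set.preimage_eq_univ_iff.mpr hfT]
  exact univ_mem

end Measure

section AtomNhd

variable {X : Type*} [MeasurableSpace X]

/-- For `μ` carried by a finite set `S`, the probability measures that give each `V x`, `x ∈ S`,
almost the mass that `μ` gives to `x`.  These sets form a basis of neighborhoods of `μ` as `V` runs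
over the disjoint families of open neighborhoods of the points of `S`. -/
def atomNhd (μ : ProbabilityMeasure X) {S : Set X} (V : S → Set X) (ε : ℝ≥0∞) :
    Set (ProbabilityMeasure X) :=
  {ν | ∀ x : S, (μ : Measure X) {x.1} ≤ (ν : Measure X) (V x) + ε}

theorem measure_le_of_mem_atomNhd {μ ν : ProbabilityMeasure X} {S : Set X} [Finite S]
    (hS : (μ : Measure X) Sᶜ = 0) {V : S → Set X} (hV : ∀ x, MeasurableSet (V x))
    (hdisj : Pairwise (Function.onFun Disjoint V)) {ε : ℝ≥0∞} (hν : ν ∈ atomNhd μ V ε)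
    (B : Set X) :
    (μ : Measure X) B ≤ (ν : Measure X) (⋃ x ∈ {x : S | x.1 ∈ B}, V x) + Nat.card S * ε := by
  classical
  have := Fintype.ofFinite S
  have hB : B ⊆ (⋃ x ∈ ({x | x.1 ∈ B} : Finset S), {x.1}) ∪ Sᶜ := fun y hy => by
    by_cases hyS : y ∈ S
    · exact .inl (Set.mem_iUnion₂.mpr ⟨⟨y, hyS⟩, by simpa using hy, rfl⟩)
    · exact .inr hyS
  calc (μ : Measure X) B
      ≤ (μ : Measure X) (⋃ x ∈ ({x | x.1 ∈ B} : Finset S), {x.1}) + (μ : Measure X) Sᶜ :=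
        (measure_mono hB).trans (measure_union_le _ _)
    _ ≤ ∑ x : S with x.1 ∈ B, (μ : Measure X) {x.1} := by
        rw [hS, add_zero]
        exact measure_biUnion_finset_le _ _
    _ ≤ ∑ x : S with x.1 ∈ B, ((ν : Measure X) (V x) + ε) := Finset.sum_le_sum fun x _ => hν x
    _ ≤ ∑ x : S with x.1 ∈ B, (ν : Measure X) (V x) + ∑ _x : S, ε := by
        rw [Finset.sum_add_distrib]
        gcongr
        exact Finset.subset_univ _
    _ = (ν : Measure X) (⋃ x ∈ {x : S | x.1 ∈ B}, V x) + Nat.card S * ε := by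
        rw [← measure_biUnion_finset (hdisj.set_pairwise _) fun x _ => hV x]
        simp

theorem measure_compl_iUnion_le_of_mem_atomNhd {μ ν : ProbabilityMeasure X} {S : Set X} [Finite S]
    (hS : (μ : Measure X) Sᶜ = 0) {V : S → Set X} (hV : ∀ x, MeasurableSet (V x))
    (hdisj : Pairwise (Function.onFun Disjoint V)) {ε : ℝ≥0∞} (hν : ν ∈ atomNhd μ V ε) :
    (ν : Measure X) (⋃ x, V x)ᶜ ≤ Nat.card S * ε := by
  rw [prob_compl_eq_one_sub (.iUnion hV), tsub_le_iff_left]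
  simpa using measure_le_of_mem_atomNhd hS hV hdisj hν Set.univ

variable [TopologicalSpace X] [TopologicalSpace.MetrizableSpace X] [BorelSpace X]

theorem atomNhd_mem_nhds (μ : ProbabilityMeasure X) {S : Set X} [Finite S] {V : S → Set X}
    (hV : ∀ x, IsOpen (V x)) (hxV : ∀ x, x.1 ∈ V x) {ε : ℝ≥0∞} (hε : 0 < ε) :
    atomNhd μ V ε ∈ 𝓝 μ := by
  let _ := TopologicalSpace.metrizableSpaceMetric X
  refine eventually_all.mpr fun x => ?_
  filter_upwards [μ.toMeasure_add_pos_gt_mem_nhds (hV x) hε] with ν hν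
  exact (measure_mono (Set.singleton_subset_iff.mpr (hxV x))).trans hν.le

theorem exists_atomNhd_subset {μ : ProbabilityMeasure X} {S : Set X} [Finite S]
    (hS : (μ : Measure X) Sᶜ = 0) {U : Set (ProbabilityMeasure X)} (hU : U ∈ 𝓝 μ) :
    ∃ V : S → Set X, ∃ ε : ℝ≥0∞, 0 < ε ∧ (∀ x, IsOpen (V x)) ∧ (∀ x, x.1 ∈ V x) ∧
      Pairwise (Function.onFun Disjoint V) ∧ atomNhd μ V ε ⊆ U := by
  let _ := TopologicalSpace.metrizableSpaceMetric X
  obtain ⟨V₀, hV₀, hdisj⟩ := S.toFinite.t2_separation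
  obtain ⟨r, hr, hrU⟩ := Metric.mem_nhds_iff.mp
    ((LevyProkhorov.continuous_toMeasure_probabilityMeasure.tendsto (.ofMeasure μ)) hU)
  let V : S → Set X := fun x => Metric.ball x.1 (r / 2) ∩ V₀ x
  have hVo : ∀ x, IsOpen (V x) := fun x => Metric.isOpen_ball.inter (hV₀ x).2
  have hVd : Pairwise (Function.onFun Disjoint V) := fun x y hxy =>
    (hdisj x.2 y.2 (Subtype.coe_ne_coe.mpr hxy)).mono Set.inter_subset_right Set.inter_subset_right
  refine ⟨V, ENNReal.ofReal (r / 2) / Nat.card S, ENNReal.div_pos (by simpa using hr) (by simp),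
    hVo, fun x => ⟨Metric.mem_ball_self (half_pos hr), (hV₀ x).1⟩, hVd, fun ν hν => ?_⟩
  suffices h : dist (LevyProkhorov.ofMeasure μ) (.ofMeasure ν) ≤ r / 2 from
    hrU (Metric.mem_ball'.mpr (h.trans_lt (half_lt_self hr)))
  rw [LevyProkhorov.dist_probabilityMeasure_def]
  refine levyProkhorovDist_le_of_forall_le _ _ (half_pos hr).le fun ε B hε _ => ?_
  refine (measure_le_of_mem_atomNhd hS (fun x => (hVo x).measurableSet) hVd hν B).trans ?_
  gcongr
  · refine Set.iUnion₂_subset fun x hx y hy => ?_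
    exact Metric.mem_thickening_iff.mpr ⟨x, hx, (Metric.mem_ball.mp hy.1).trans hε⟩
  · exact ENNReal.mul_div_le.trans (ENNReal.ofReal_le_ofReal hε.le)

end AtomNhd

section Itineraries

theorem isIndependenceSet_iff {Γ Y : Type*} [SMul Γ Y] [Nonempty Y] {k : ℕ} {A : Fin k → Set Y}
    {F : Set Γ} (hF : F.Finite) :
    IsIndependenceSet A F ↔ ∀ τ : Γ → Fin k, ∃ y : Y, ∀ s ∈ F, s • y ∈ A (τ s) := by
  refine ⟨fun h τ => ?_, fun h J hJ hJF σ => ?_⟩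
  · rcases F.eq_empty_or_nonempty with rfl | hne
    · simp
    · obtain ⟨y, hy⟩ := h hF.toFinset (by simpa using hne) (by simp) fun s => τ s
      exact ⟨y, fun s hs => Set.mem_iInter.mp hy ⟨s, by simpa using hs⟩⟩
  · obtain ⟨s₀, hs₀⟩ := hJ
    obtain ⟨y, hy⟩ := h (Function.extend Subtype.val σ fun _ => σ ⟨s₀, hs₀⟩)
    refine ⟨y, Set.mem_iInter.mpr fun s => ?_⟩
    simpa [Subtype.val_injective.extend_apply] using hy s (hJF s.2)

variable {Γ X : Type*} [SMul Γ X] {k : ℕ} {I : Fin k → Type*}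

/-- The points that `e 0, …, e (k - 1)` move into `V 0 (φ 0), …, V (k - 1) (φ (k - 1))`. -/
def itineraryCell (V : ∀ j, I j → Set X) (e : Fin k → Γ) (φ : ∀ j, I j) : Set X :=
  {y | ∀ j, e j • y ∈ V j (φ j)}

/-- The choices of one member from each family `V j` that yield a tuple for which `A` is an
independence set. -/
def independentChoices (V : ∀ j, I j → Set X) (A : Set Γ) : Set (∀ j, I j) :=
  {φ | IsIndependenceSet (fun j => V j (φ j)) A}

theorem mem_independentChoices_iff [Nonempty X] {V : ∀ j, I j → Set X} {A : Set Γ}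
    (hA : A.Finite) {φ : ∀ j, I j} :
    φ ∈ independentChoices V A ↔
      ∀ τ : Γ → Fin k, ∃ y : X, ∀ s ∈ A, s • y ∈ V (τ s) (φ (τ s)) :=
  isIndependenceSet_iff (A := fun j => V j (φ j)) hA

/-- The pairs `(τ, φ)` for which some point is moved by each `s i` into `V (τ i) (φ (τ i))`.  This
is the color of the tuple `s` to which Ramsey's theorem is applied. -/
def realizedPatterns (V : ∀ j, I j → Set X) {m : ℕ} (s : Fin m → Γ) :
    Set ((Fin m → Fin k) × ∀ j, I j) :=
  {p | ∃ y, ∀ i, s i • y ∈ V (p.1 i) (p.2 (p.1 i))}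

theorem pairwise_disjoint_itineraryCell {V : ∀ j, I j → Set X}
    (hdisj : ∀ j, Pairwise (Function.onFun Disjoint (V j))) (e : Fin k → Γ) :
    Pairwise (Function.onFun Disjoint (itineraryCell V e)) := fun φ ψ hne => by
  obtain ⟨j, hj⟩ := Function.ne_iff.mp hne
  exact Set.disjoint_left.mpr fun y hφ hψ => Set.disjoint_left.mp (hdisj j hj) (hφ j) (hψ j)

theorem measurableSet_itineraryCell [MeasurableSpace X] [MeasurableConstSMul Γ X]
    {V : ∀ j, I j → Set X} (hV : ∀ j x, MeasurableSet (V j x)) (e : Fin k → Γ) (φ : ∀ j, I j) :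
    MeasurableSet (itineraryCell V e φ) := by
  simp only [itineraryCell, Set.ofPred_forall]
  exact .iInter fun j => measurable_const_smul (e j) (hV j (φ j))

theorem ncard_block_mem_itineraryCell_le [Nonempty X] {B : Type*} [LinearOrder B] [Finite B]
    {V : ∀ j, I j → Set X} {u : B ×ₗ Fin k → Γ} {m : ℕ} {d : Set ((Fin m → Fin k) × ∀ j, I j)}
    (hu : ∀ a : Fin m → B ×ₗ Fin k, StrictMono a → realizedPatterns V (u ∘ a) = d)
    {a₀ : Fin m → B ×ₗ Fin k} (ha₀ : StrictMono a₀) {φ : ∀ j, I j}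
    (hφ : φ ∉ independentChoices V (Set.range (u ∘ a₀))) (y : X) :
    {b | y ∈ itineraryCell V (fun j => u (toLex (b, j))) φ}.ncard ≤ m := by
  contrapose! hφ with hm
  refine (mem_independentChoices_iff (Set.finite_range _)).mpr fun τ => ?_
  rw [Set.ncard_eq_toFinset_card _] at hm
  let b : Fin m ↪o B := Finset.orderEmbOfCardLe _ hm.le
  have hb : ∀ i, y ∈ itineraryCell V (fun j => u (toLex (b i, j))) φ := fun i => by
    simpa using Finset.orderEmbOfCardLe_mem _ hm.le i
  -- One element from each of `m` blocks is an increasing tuple, whichever elements `τ` asks for.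
  let a : Fin m → B ×ₗ Fin k := fun i => toLex (b i, τ (u (a₀ i)))
  have ha : StrictMono a := fun i i' hi => Prod.Lex.toLex_lt_toLex.mpr (.inl (b.strictMono hi))
  have hrealized : (τ ∘ u ∘ a₀, φ) ∈ realizedPatterns V (u ∘ a) := ⟨y, fun i => hb i _⟩
  rw [hu a ha, ← hu a₀ ha₀] at hrealized
  simpa [realizedPatterns] using hrealized

theorem exists_measure_dependent_cells_le [MeasurableSpace X] [MeasurableConstSMul Γ X]
    [∀ j, Finite (I j)] [NeZero k] {V : ∀ j, I j → Set X} (hV : ∀ j x, MeasurableSet (V j x))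
    (m : ℕ) {δ : ℝ≥0∞} (hδ : 0 < δ) :
    ∃ M : ℕ, ∀ F : Finset Γ, M ≤ F.card → ∃ A : Finset Γ, A.card = m ∧ ∃ σ : Γ → Fin k,
      ∀ (ν : Measure X) [IsProbabilityMeasure ν], ∃ e : Fin k → Γ,
        (∀ j, e j ∈ F ∧ σ (e j) = j) ∧
          ν (⋃ φ ∈ (independentChoices V (A : Set Γ))ᶜ, itineraryCell V e φ) ≤ δ := by
  obtain ⟨n₀, hn₀⟩ := ENNReal.exists_nat_mul_gt hδ.ne'
    (show Nat.card (∀ j, I j) * (m : ℝ≥0∞) ≠ ⊤ by finiteness)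
  obtain ⟨n, hn₀n, hmn⟩ : ∃ n, n₀ ≤ n ∧ m ≤ n := ⟨_, le_max_left _ _, le_max_right _ _⟩
  have hn : Nat.card (∀ j, I j) * (m : ℝ≥0∞) < n * δ := hn₀.trans_le (by gcongr)
  have : NeZero n := ⟨by rintro rfl; simp at hn⟩
  obtain ⟨M, hM⟩ := exists_homogeneous_embedding Γ (Set ((Fin m → Fin k) × ∀ j, I j))
    (Fin n ×ₗ Fin k) m
  refine ⟨M, fun F hF => ?_⟩
  obtain ⟨u, huF, d, hd⟩ := hM (realizedPatterns V) F hF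
  let a₀ : Fin m ↪o Fin n ×ₗ Fin k := OrderEmbedding.ofStrictMono
    (fun i => toLex (Fin.castLE hmn i, 0)) fun i i' hi => Prod.Lex.toLex_lt_toLex.mpr (.inl hi)
  refine ⟨Finset.univ.map (a₀.toEmbedding.trans u), by simp,
    Function.extend u (fun l => (ofLex l).2) 0, fun ν _ => ?_⟩
  have := nonempty_of_isProbabilityMeasure ν
  let D := (independentChoices V (Set.range (u ∘ a₀)))ᶜ
  have hD : Nat.card D * (m : ℝ≥0∞) ≤ Nat.card (Fin n) * δ :=
    calc Nat.card D * (m : ℝ≥0∞) ≤ Nat.card (∀ j, I j) * m := by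
          gcongr
          exact Finite.card_subtype_le _
      _ ≤ Nat.card (Fin n) * δ := by simpa using hn.le
  obtain ⟨b, hb⟩ := exists_measure_iUnion_le ν
    (C := fun b (φ : D) => itineraryCell V (fun j => u (toLex (b, j))) φ)
    (fun b φ => measurableSet_itineraryCell hV _ _)
    (fun φ y => ncard_block_mem_itineraryCell_le hd a₀.strictMono φ.2 y) hD
  refine ⟨fun j => u (toLex (b, j)), fun j => ⟨huF _, by simp [u.injective.extend_apply]⟩, ?_⟩
  rw [Set.biUnion_eq_iUnion]
  simpa [D, Function.comp_def] using hb

end Itineraries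

section Redistribution

variable {Γ X : Type*} [Group Γ] [TopologicalSpace X] [MeasurableSpace X] [BorelSpace X]
  [MulAction Γ X] [ContinuousConstSMul Γ X] {k : ℕ}

theorem probabilityMeasure_smul_apply (g : Γ) (ν : ProbabilityMeasure X) {B : Set X}
    (hB : MeasurableSet B) :
    ((g • ν : ProbabilityMeasure X) : Measure X) B = (ν : Measure X) ((g • ·) ⁻¹' B) := by
  rw [probabilityMeasure_toMeasure_smul, Measure.map_apply (measurable_const_smul g) hB]

theorem exists_encard_support_le_and_smul_apply_le [T1Space X] {I : Fin k → Type*}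
    [∀ j, Finite (I j)] [∀ j, Nonempty (I j)] {V : ∀ j, I j → Set X}
    (hV : ∀ j x, MeasurableSet (V j x)) (hdisj : ∀ j, Pairwise (Function.onFun Disjoint (V j)))
    (A : Finset Γ) (ν : ProbabilityMeasure X) (e : Fin k → Γ) (τ : Γ → Fin k) :
    ∃ ρ : ProbabilityMeasure X,
      (ρ : Measure X).support.encard ≤ Nat.card (∀ j, I j) ∧
      ∀ s ∈ A, ∀ x, ((e (τ s) • ν : ProbabilityMeasure X) : Measure X) (V (τ s) x) ≤
        ((s • ρ : ProbabilityMeasure X) : Measure X) (V (τ s) x) +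
          (ν : Measure X) (⋃ φ ∈ independentChoices V (A : Set Γ), itineraryCell V e φ)ᶜ := by
  have : Nonempty X := nonempty_of_isProbabilityMeasure (ν : Measure X)
  have hz : ∀ φ, ∃ z : X, φ ∈ independentChoices V (A : Set Γ) →
      ∀ s ∈ A, s • z ∈ V (τ s) (φ (τ s)) := fun φ => by
    by_cases hφ : φ ∈ independentChoices V (A : Set Γ)
    · obtain ⟨z, hz⟩ := (mem_independentChoices_iff A.finite_toSet).mp hφ τ
      exact ⟨z, fun _ => hz⟩
    · exact ⟨Classical.arbitrary X, fun h => absurd h hφ⟩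
  choose z hz using hz
  obtain ⟨f, hf, hfz, hfC⟩ := exists_measurable_eq_on_cells
    (measurableSet_itineraryCell hV e) (pairwise_disjoint_itineraryCell hdisj e) z
  refine ⟨ν.map hf.aemeasurable, ?_, fun s hs x => ?_⟩
  · have hsupp := support_map_subset_of_range_subset (ν : Measure X) hf
      (Set.finite_range z).isClosed hfz
    calc (ν.map hf.aemeasurable : Measure X).support.encard
        ≤ (z '' Set.univ).encard := Set.encard_le_encard (by rwa [Set.image_univ])
      _ ≤ Nat.card (∀ j, I j) := by
        simpa [ENat.card_eq_coe_natCard] using Set.encard_image_le z Set.univ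
  · rw [probabilityMeasure_smul_apply _ _ (hV _ _), probabilityMeasure_smul_apply _ _ (hV _ _),
      ProbabilityMeasure.toMeasure_map,
      Measure.map_apply hf (measurable_const_smul s (hV _ _))]
    refine (measure_mono fun y hy => ?_).trans (measure_union_le _ _)
    by_cases hgood : y ∈ ⋃ φ ∈ independentChoices V (A : Set Γ), itineraryCell V e φ
    · obtain ⟨φ, hφ, hyφ⟩ := Set.mem_iUnion₂.mp hgood
      have hφx : φ (τ s) = x := by
        by_contra hne
        exact Set.disjoint_left.mp (hdisj (τ s) hne) (hyφ (τ s)) hy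
      left
      rw [Set.mem_preimage, Set.mem_preimage, hfC φ y hyφ, ← hφx]
      exact hz φ hφ s hs
    · exact .inr hgood

variable {μ : Fin k → ProbabilityMeasure X} {S : Fin k → Set X} [∀ j, Finite (S j)]
  {V : ∀ j, S j → Set X} {e : Fin k → Γ} {ν : ProbabilityMeasure X} {δ : ℝ≥0∞}

theorem measure_compl_independent_cells_le (hS : ∀ j, (μ j : Measure X) (S j)ᶜ = 0)
    (hV : ∀ j x, MeasurableSet (V j x)) (hdisj : ∀ j, Pairwise (Function.onFun Disjoint (V j)))
    (he : ∀ j, e j • ν ∈ atomNhd (μ j) (V j) δ) {A : Set Γ}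
    (hA : (ν : Measure X) (⋃ φ ∈ (independentChoices V A)ᶜ, itineraryCell V e φ) ≤ δ) :
    (ν : Measure X) (⋃ φ ∈ independentChoices V A, itineraryCell V e φ)ᶜ ≤
      δ + ∑ j, Nat.card (S j) * δ := by
  have hcover : (⋃ φ ∈ independentChoices V A, itineraryCell V e φ)ᶜ ⊆
      (⋃ φ ∈ (independentChoices V A)ᶜ, itineraryCell V e φ) ∪
        ⋃ j, (e j • ·) ⁻¹' (⋃ x, V j x)ᶜ := fun y hy => by
    by_contra h
    simp only [Set.mem_union, Set.mem_iUnion, Set.mem_preimage, Set.mem_compl_iff, not_or,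
      not_exists, not_forall, not_not] at h hy
    choose φ hφ using h.2
    exact h.1 φ (hy φ · hφ) hφ
  refine (measure_mono hcover).trans ((measure_union_le _ _).trans (add_le_add hA ?_))
  refine (measure_iUnion_fintype_le _ _).trans (Finset.sum_le_sum fun j _ => ?_)
  rw [← probabilityMeasure_smul_apply _ _ (MeasurableSet.iUnion (hV j)).compl]
  exact measure_compl_iUnion_le_of_mem_atomNhd (hS j) (hV j) (hdisj j) (he j)

theorem exists_forall_smul_mem_atomNhd [T1Space X] (hS : ∀ j, (μ j : Measure X) (S j)ᶜ = 0)
    (hV : ∀ j x, MeasurableSet (V j x)) (hdisj : ∀ j, Pairwise (Function.onFun Disjoint (V j)))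
    (he : ∀ j, e j • ν ∈ atomNhd (μ j) (V j) δ) {A : Finset Γ}
    (hA : (ν : Measure X) (⋃ φ ∈ (independentChoices V (A : Set Γ))ᶜ, itineraryCell V e φ) ≤ δ)
    (τ : Γ → Fin k) :
    ∃ ρ : ProbabilityMeasure X, (ρ : Measure X).support.encard ≤ ∏ j, (S j).encard ∧
      ∀ s ∈ A, s • ρ ∈ atomNhd (μ (τ s)) (V (τ s)) ((∑ j, Nat.card (S j) + 2 : ℕ) * δ) := by
  have : ∀ j, Nonempty (S j) := fun j => Set.nonempty_coe_sort.mpr <|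
    Set.nonempty_iff_ne_empty.mpr fun h => by simpa [h] using hS j
  obtain ⟨ρ, hρ, hle⟩ := exists_encard_support_le_and_smul_apply_le hV hdisj A ν e τ
  refine ⟨ρ, hρ.trans_eq ?_, fun s hs x => ?_⟩
  · simp [Nat.card_pi]
  calc (μ (τ s) : Measure X) {x.1}
      ≤ ((e (τ s) • ν : ProbabilityMeasure X) : Measure X) (V (τ s) x) + δ := he (τ s) x
    _ ≤ ((s • ρ : ProbabilityMeasure X) : Measure X) (V (τ s) x) +
          (δ + ∑ j, Nat.card (S j) * δ) + δ := by
        gcongr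
        exact (hle s hs x).trans
          (add_le_add_right (measure_compl_independent_cells_le hS hV hdisj he hA) _)
    _ = ((s • ρ : ProbabilityMeasure X) : Measure X) (V (τ s) x) +
          (∑ j, Nat.card (S j) + 2 : ℕ) * δ := by
        push_cast
        rw [← Finset.sum_mul]
        ring

end Redistribution

section INTuples

variable {Γ X : Type*} [Group Γ] [TopologicalSpace X] [TopologicalSpace.MetrizableSpace X]
  [MeasurableSpace X] [BorelSpace X] [MulAction Γ X] [ContinuousConstSMul Γ X]

theorem exists_forall_smul_mem_of_mem_INTuples {k : ℕ} [NeZero k]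
    {μ : Fin k → ProbabilityMeasure X} (hμ : μ ∈ INTuples Γ (ProbabilityMeasure X) k)
    {S : Fin k → Set X} [∀ j, Finite (S j)] (hS : ∀ j, (μ j : Measure X) (S j)ᶜ = 0)
    {U : Fin k → Set (ProbabilityMeasure X)} (hU : ∀ j, U j ∈ 𝓝 (μ j)) (n : ℕ) :
    ∃ A : Finset Γ, A.card = n ∧ ∀ τ : Γ → Fin k, ∃ ρ : ProbabilityMeasure X,
      (ρ : Measure X).support.encard ≤ ∏ j, (S j).encard ∧ ∀ s ∈ A, s • ρ ∈ U (τ s) := by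
  choose V ε hε hVo hxV hdisj hVU using fun j => exists_atomNhd_subset (hS j) (hU j)
  have hV : ∀ j x, MeasurableSet (V j x) := fun j x => (hVo j x).measurableSet
  obtain ⟨i, hi⟩ := Finite.exists_min ε
  let C : ℕ := ∑ j, Nat.card (S j) + 2
  have hδ : 0 < ε i / C := ENNReal.div_pos (hε i).ne' (by finiteness)
  obtain ⟨M, hM⟩ := exists_measure_dependent_cells_le (Γ := Γ) hV n hδ
  let W : Fin k → Set (ProbabilityMeasure X) := fun j => atomNhd (μ j) (V j) (ε i / C)
  obtain ⟨F, hFM, hF⟩ := hμ W (fun j => atomNhd_mem_nhds (μ j) (hVo j) (hxV j) hδ) M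
  obtain ⟨A, hAn, σ, hσ⟩ := hM F hFM
  have : Nonempty (ProbabilityMeasure X) := ⟨μ 0⟩
  obtain ⟨ν, hν⟩ := (isIndependenceSet_iff F.finite_toSet).mp hF σ
  obtain ⟨e, he, hνA⟩ := hσ ν
  refine ⟨A, hAn, fun τ => ?_⟩
  have heν : ∀ j, e j • ν ∈ W j := fun j => by simpa only [(he j).2] using hν (e j) (he j).1
  obtain ⟨ρ, hρ, hρA⟩ := exists_forall_smul_mem_atomNhd hS hV hdisj heν hνA τ
  refine ⟨ρ, hρ, fun s hs => hVU _ fun x => (hρA s hs x).trans ?_⟩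
  gcongr
  exact ENNReal.mul_div_le.trans (hi _)

theorem corollary1p5_general [SecondCountableTopology X] (k : ℕ) (hk : 1 ≤ k) (N : Fin k → ℕ) :
    (Set.univ.pi fun j => (finSuppMeasures Γ X (N j) : Set (ProbabilityMeasure X))) ∩
        INTuples Γ (ProbabilityMeasure X) k ⊆
      (fun (ν : Fin k → finSuppMeasures Γ X (∏ j, N j)) (j : Fin k) =>
        (ν j : ProbabilityMeasure X)) '' INTuples Γ (finSuppMeasures Γ X (∏ j, N j)) k := by
  rintro μ ⟨hμN, hμ⟩
  have : NeZero k := .of_pos hk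
  have hcard : ∀ j, (μ j : Measure X).support.encard ≤ N j := fun j => hμN j (Set.mem_univ j)
  have hN : ∀ j, 1 ≤ N j := fun j => by
    exact_mod_cast (Set.one_le_encard_iff_nonempty.mpr
      ((μ j : Measure X).nonempty_support (NeZero.ne _))).trans (hcard j)
  have hfin : ∀ j, Finite (μ j : Measure X).support := fun j =>
    Set.finite_of_encard_le_coe (hcard j)
  have hprod : ∏ j, (μ j : Measure X).support.encard ≤ (∏ j, N j : ℕ) := by
    push_cast
    exact Finset.prod_le_prod' fun j _ => hcard j
  let μ' : Fin k → finSuppMeasures Γ X (∏ j, N j) := fun j => ⟨μ j, (hcard j).trans <| by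
    exact_mod_cast Finset.single_le_prod' (fun i _ => hN i) (Finset.mem_univ j)⟩
  refine ⟨μ', fun U hU n => ?_, rfl⟩
  choose W hW hWU using fun j => (mem_nhds_subtype _ _ _).mp (hU j)
  obtain ⟨A, hA, hAW⟩ := exists_forall_smul_mem_of_mem_INTuples hμ
    (fun _ => Measure.measure_compl_support) hW n
  have : Nonempty (finSuppMeasures Γ X (∏ j, N j)) := ⟨μ' 0⟩
  refine ⟨A, hA.ge, (isIndependenceSet_iff A.finite_toSet).mpr fun τ => ?_⟩
  obtain ⟨ρ, hρ, hρW⟩ := hAW τ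
  exact ⟨⟨ρ, hρ.trans hprod⟩, fun s hs => hWU _ (hρW s hs)⟩

end INTuples

theorem corollary1p5 {Γ X : Type*} [Group Γ] [Countable Γ] [Infinite Γ]
    [TopologicalSpace X] [CompactSpace X] [TopologicalSpace.MetrizableSpace X]
    [MeasurableSpace X] [BorelSpace X] [MulAction Γ X] [ContinuousConstSMul Γ X]
    (k : ℕ) (hk : 1 ≤ k) (N : Fin k → ℕ) (hN : ∀ j, 1 ≤ N j) :
    (Set.univ.pi fun j => (finSuppMeasures Γ X (N j) : Set (ProbabilityMeasure X))) ∩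
        INTuples Γ (ProbabilityMeasure X) k ⊆
      (fun (ν : Fin k → finSuppMeasures Γ X (∏ j, N j)) (j : Fin k) =>
        (ν j : ProbabilityMeasure X)) '' INTuples Γ (finSuppMeasures Γ X (∏ j, N j)) k := by
  exact corollary1p5_general k hk N
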